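/- Let $f=(f^1,f^2)$ be a smooth $\mathbb R^2$-valued function of $(x,y)=(x^1,x^2,y^1,y^2)\in\mathbb R^4$ with $\det(\partial f^i/\partial x^j)\neq0$, $\det(\partial f^i/\partial y^j)\ne0$ on an open set. The foliations $x=\mathrm{const}$, $y=\mathrm{const}$, $f=\mathrm{const}$ form a three-web $W(3,2,2)$ there. Put $\omega_1^i=\frac{\partial f^i}{\partial x^j}dx^j$, $\omega_2^i=\frac{\partial f^i}{\partial y^j}dy^j$ and $$\Gamma^i_{jk}=-\frac{\partial^2f^i}{\partial x^l\partial y^m}\,\bar g^l_j\,\tilde g^m_k,\qquad \omega^i_j=\Gamma^i_{kj}\omega_1^k+\Gamma^i_{jk}\omega_2^k ,$$ where $\bar g,\tilde g$ are the inverses of the matrices $(\partial f^i/\partial x^j)$, $(\partial f^i/\partial y^j)$. The covector $a=(a_1,a_2)$, the quantities $p_{ij},q_{ij},p,q$ and the curvature tensor $b^i_{jkl}$ are determined by $$\Gamma^i_{[jk]}=a_{[j}\delta^i_{k]},\quad \nabla a_i:=da_i-a_j\omega_i^j=p_{ij}\omega_1^j+q_{ij}\omega_2^j,\quad p=p_{[12]},\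 q=q_{[12]},\quad d\omega^i_j-\omega_j^m\wedge\omega_m^i=b^i_{jkl}\,\omega_1^k\wedge\omega_2^l .$$ A field of subspaces of the tangent spaces is integrable as a $k$-dimensional distribution on $U$ if through every point of $U$ passes a smooth $k$-dimensional submanifold of $U$ whose tangent space at each of its points is the given subspace. Consider the following classes of webs on $U$ (conditions on functions are required at every point of $U$). * $\mathbf{G_3}$: $p=q\neq0$. * $\mathbf{E_{111}}$: $a_1\ne0$, $a_2\neq0$, $a_1\ne a_2$; $p_{i2}=q_{i1}=0$ for $i=1,2$; and $p_{21}=-q_{12}$. * $\mathbf B$: the transversal distribution $a_1\omega_1^1+a_2\omega_1^2=0,\ a_1\omega_2^1+a_2\omega_2^2=0$ is not integrable as a 2-dimensional distribution on $U$, and the conditions $a_2^2p_{11}-2a_1a_2p_{(12)}+a_1^2p_{22}=0$, $a_2^2q_{11}-2a_1a_2q_{(12)}+a_1^2q_{22}=0$ do not both hold throughout $U$. * $\mathbf C$: the web is not transversally geodesic on $U$, i.e. it is not true that for every point of $U$ and every $\xi\ne0$ the plane $\xi^2\omega_1^1-\xi^1\omega_1^2=0,\ \xi^2\omega_2^1-\xi^1\omega_2^2=0$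 at this point is tangent to a smooth surface in $U$ all of whose tangent planes are of this form (with varying $\xi\neq 0$); and it is not true that at every point of $U$ one has $b^i_{(jkl)}=\delta^i_{(j}b_{kl)}$ for some $b_{kl}$. **Statement.** Let $$f^1=x^1+y^1+\tfrac12(x^1)^2y^2,\qquad f^2=x^2+y^2+\tfrac12x^1(y^2)^2,$$ and let $U\subset\mathbb R^4$ be any nonempty open set on which $1+x^1y^2\neq0$. Then these functions define a three-web on $U$, and: 1. If $a\neq0$ at every point of $U$, then the condition $p_{21}=-q_{12}$ on $U$ is necessary and sufficient for the distribution $a_1\omega_1^1-a_2\omega_2^2=0$ to be integrable (as a 3-dimensional distribution) on $U$. Moreover, on $U$ (without this restriction), $d(a_1\omega_1^1-a_2\omega_2^2)=\nabla a_1\wedge\omega_1^1-\nabla a_2\wedge\omega_2^2$, and at each point $\nabla a_1\wedge\omega_1^1=\nabla a_2\wedge\omega_2^2$ if and only if $p_{21}=-q_{12}$. 2. The 3-dimensional distributions $\omega_1^i+\omega_2^i=0$, $i=1,2$, are integrable on $U$. 3. At every point of $U$: $p=q$, $p_{i2}=q_{i1}=0$ for $i=1,2$, and $p_{21}=-q_{12}$.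 The web belongs to $\mathbf{G_3}$ on $U$ if and only if $x^1y^2\neq1$ on $U$; it belongs to $\mathbf{E_{111}}$ on $U$ if and only if $x^1\neq0$, $y^2\neq0$ and $x^1\neq-y^2$ on $U$; it belongs to $\mathbf B$ and $\mathbf C$ on $U$. The set of points of $\mathbb R^4$ with $1+x^1y^2\ne0$, $x^1y^2\neq1$, $x^1\neq0$, $y^2\neq0$, $x^1\neq-y^2$ is dense, so the web lies in $\mathbf{G_3}$, $\mathbf{E_{111}}$, $\mathbf B$ and $\mathbf C$ on a dense open subset of $\mathbb R^4$. -/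

import Mathlib

open scoped ContDiff

/-!
Four-dimensional three-webs of codimension two on open sets of `ℝ² × ℝ²`, given by the foliations
`x = const`, `y = const`, `f (x, y) = const`.  A point is `P = (x, y)`, with `xⁱ = P.1 i`,
`yⁱ = P.2 i`; the indices `1, 2` of the mathematics are `0, 1 : Fin 2`.
-/

namespace ThreeWeb

/-- The ambient space `ℝ² × ℝ²` of the coordinates `(x¹, x², y¹, y²)`. -/
abbrev Space : Type := (Fin 2 → ℝ) × (Fin 2 → ℝ)

/-- One-forms on `ℝ² × ℝ²`. -/
abbrev OneForm : Type := Space → Space →L[ℝ] ℝ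

/-- The coordinate form `dxʲ`. -/
noncomputable def dx (j : Fin 2) : Space →L[ℝ] ℝ :=
  (ContinuousLinearMap.proj j : (Fin 2 → ℝ) →L[ℝ] ℝ).comp
    (ContinuousLinearMap.fst ℝ (Fin 2 → ℝ) (Fin 2 → ℝ))

/-- The coordinate form `dyʲ`. -/
noncomputable def dy (j : Fin 2) : Space →L[ℝ] ℝ :=
  (ContinuousLinearMap.proj j : (Fin 2 → ℝ) →L[ℝ] ℝ).comp
    (ContinuousLinearMap.snd ℝ (Fin 2 → ℝ) (Fin 2 → ℝ))

/-- `∂g/∂xʲ`. -/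
noncomputable def ddx (j : Fin 2) (g : Space → ℝ) (P : Space) : ℝ :=
  fderiv ℝ g P (Pi.single j 1, 0)

/-- `∂g/∂yʲ`. -/
noncomputable def ddy (j : Fin 2) (g : Space → ℝ) (P : Space) : ℝ :=
  fderiv ℝ g P (0, Pi.single j 1)

/-- The exterior derivative of a one-form, as a function of two vectors. -/
noncomputable def extD (θ : OneForm) (P u v : Space) : ℝ :=
  fderiv ℝ θ P u v - fderiv ℝ θ P v u

/-- The exterior product of two covectors, as a function of two vectors. -/
def wedge (α β : Space →L[ℝ] ℝ) (u v : Space) : ℝ := α u * β v - α v * β u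

section Web

variable (f : Space → Fin 2 → ℝ)

/-- The matrix `∂fⁱ/∂xʲ`. -/
noncomputable def fBar (P : Space) : Matrix (Fin 2) (Fin 2) ℝ :=
  Matrix.of fun i j => ddx j (fun Q => f Q i) P

/-- The matrix `∂fⁱ/∂yʲ`. -/
noncomputable def fTilde (P : Space) : Matrix (Fin 2) (Fin 2) ℝ :=
  Matrix.of fun i j => ddy j (fun Q => f Q i) P

/-- The foliations `x = const`, `y = const`, `f (x, y) = const` form a (smooth) three-web on the
open set `U`: the leaves through each point are pairwise transversal. -/
def IsThreeWeb (U : Set Space) : Prop :=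
  IsOpen U ∧ ContDiffOn ℝ ∞ f U ∧ ∀ P ∈ U, (fBar f P).det ≠ 0 ∧ (fTilde f P).det ≠ 0

/-- The form `ωⁱ` of the first foliation, `(∂fⁱ/∂xʲ) dxʲ`. -/
noncomputable def om1 (i : Fin 2) : OneForm := fun P => ∑ j, fBar f P i j • dx j

/-- The form `ωⁱ` of the second foliation, `(∂fⁱ/∂yʲ) dyʲ`. -/
noncomputable def om2 (i : Fin 2) : OneForm := fun P => ∑ j, fTilde f P i j • dy j

/-- The frame vector dual to the first form of index `j`: it is killed by both second forms. -/
noncomputable def frame1 (j : Fin 2) (P : Space) : Space := (fun m => (fBar f P)⁻¹ m j, 0)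

/-- The frame vector dual to the second form of index `j`: it is killed by both first forms. -/
noncomputable def frame2 (j : Fin 2) (P : Space) : Space := (0, fun m => (fTilde f P)⁻¹ m j)

/-- `Γⁱⱼₖ`, the coefficients in `dω₁ⁱ = - dω₂ⁱ = Γⁱⱼₖ ω₁ʲ ∧ ω₂ᵏ`. -/
noncomputable def Gam (i j k : Fin 2) (P : Space) : ℝ :=
  -∑ l, ∑ m, ddx l (ddy m (fun Q => f Q i)) P * (fBar f P)⁻¹ l j * (fTilde f P)⁻¹ m k

/-- The connection form with lower index `j` and upper index `i`:
`ωⱼⁱ = Γⁱₖⱼ ω₁ᵏ + Γⁱⱼₖ ω₂ᵏ`. -/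
noncomputable def conn (j i : Fin 2) : OneForm := fun P =>
  ∑ k, (Gam f i k j P • om1 f k P + Gam f i j k P • om2 f k P)

/-- The torsion tensor `aⁱⱼₖ = Γⁱ_[jk]`. -/
noncomputable def torsion (i j k : Fin 2) (P : Space) : ℝ :=
  (Gam f i j k P - Gam f i k j P) / 2

/-- The covector `a` of the web; it is determined by `torsion_eq` below. -/
noncomputable def covec (j : Fin 2) (P : Space) : ℝ := 2 * ∑ i, torsion f i j i P

/-- `aⁱⱼₖ = a_[j δⁱ_k]`. -/
theorem torsion_eq (i j k : Fin 2) (P : Space) :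
    torsion f i j k P =
      (covec f j P * (if i = k then 1 else 0) - covec f k P * (if i = j then 1 else 0)) / 2 := by
  fin_cases i <;> fin_cases j <;> fin_cases k <;>
    simp [covec, torsion, Fin.sum_univ_two] <;> ring

/-- The covariant differential `∇aᵢ = daᵢ - aⱼ ωᵢʲ`. -/
noncomputable def nablaA (i : Fin 2) : OneForm := fun P =>
  fderiv ℝ (covec f i) P - ∑ j, covec f j P • conn f i j P

/-- `pᵢⱼ`, from `∇aᵢ = pᵢⱼ ω₁ʲ + qᵢⱼ ω₂ʲ`. -/
noncomputable def pT (i j : Fin 2) (P : Space) : ℝ := nablaA f i P (frame1 f j P)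

/-- `qᵢⱼ`, from `∇aᵢ = pᵢⱼ ω₁ʲ + qᵢⱼ ω₂ʲ`. -/
noncomputable def qT (i j : Fin 2) (P : Space) : ℝ := nablaA f i P (frame2 f j P)

/-- `p = p_[12]`. -/
noncomputable def pAlt (P : Space) : ℝ := (pT f 0 1 P - pT f 1 0 P) / 2

/-- `q = q_[12]`. -/
noncomputable def qAlt (P : Space) : ℝ := (qT f 0 1 P - qT f 1 0 P) / 2

/-- The curvature tensor `bⁱⱼₖₗ`, from `dωⱼⁱ - ωⱼᵐ ∧ ωₘⁱ = bⁱⱼₖₗ ω₁ᵏ ∧ ω₂ˡ`. -/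
noncomputable def curv (i j k l : Fin 2) (P : Space) : ℝ :=
  extD (conn f j i) P (frame1 f k P) (frame2 f l P) -
    ∑ m, wedge (conn f j m P) (conn f m i P) (frame1 f k P) (frame2 f l P)

end Web

/-- Symmetrization `T_(jkl)` of a quantity with three indices. -/
noncomputable def sym3 (T : Fin 2 → Fin 2 → Fin 2 → ℝ) (j k l : Fin 2) : ℝ :=
  (T j k l + T j l k + T k j l + T k l j + T l j k + T l k j) / 6

/-- A field `D` of subspaces is integrable on `U` as a `k`-dimensional distribution: through each
point of `U` passes a smooth `k`-dimensional integral submanifold (given by a local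
parametrization) whose tangent space at each of its points is the subspace there. -/
def IsIntegrable (k : ℕ) (D : Space → Submodule ℝ Space) (U : Set Space) : Prop :=
  ∀ P ∈ U, ∃ (W : Set (Fin k → ℝ)) (φ : (Fin k → ℝ) → Space),
    IsOpen W ∧ (0 : Fin k → ℝ) ∈ W ∧ φ 0 = P ∧ Set.MapsTo φ W U ∧ ContDiffOn ℝ ∞ φ W ∧
    ∀ w ∈ W, Function.Injective (fderiv ℝ φ w) ∧
      LinearMap.range (fderiv ℝ φ w).toLinearMap = D (φ w)

section Classes

variable (f : Space → Fin 2 → ℝ)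

/-- The distribution `a₁ ω₁¹ + a₂ ω₁² = 0`, `a₁ ω₂¹ + a₂ ω₂² = 0`
(the transversal `a`-distribution). -/
noncomputable def transversalDist (P : Space) : Submodule ℝ Space :=
  LinearMap.ker (covec f 0 P • om1 f 0 P + covec f 1 P • om1 f 1 P).toLinearMap ⊓
    LinearMap.ker (covec f 0 P • om2 f 0 P + covec f 1 P • om2 f 1 P).toLinearMap

/-- The form `a₁ ω₁¹ - a₂ ω₂²`. -/
noncomputable def thetaForm : OneForm := fun P =>
  covec f 0 P • om1 f 0 P - covec f 1 P • om2 f 1 P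

/-- The distribution `a₁ ω₁¹ - a₂ ω₂² = 0`. -/
noncomputable def thetaDist (P : Space) : Submodule ℝ Space :=
  LinearMap.ker (thetaForm f P).toLinearMap

/-- The distribution `ω₁ⁱ + ω₂ⁱ = 0`. -/
noncomputable def sumDist (i : Fin 2) (P : Space) : Submodule ℝ Space :=
  LinearMap.ker (om1 f i P + om2 f i P).toLinearMap

/-- The pair of algebraic conditions expressing integrability of the transversal
`a`-distribution through `a`, `p`, `q`. -/
def TransversalCondition (P : Space) : Prop :=
  covec f 1 P ^ 2 * pT f 0 0 P
      - 2 * covec f 0 P * covec f 1 P * ((pT f 0 1 P + pT f 1 0 P) / 2)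
      + covec f 0 P ^ 2 * pT f 1 1 P = 0 ∧
  covec f 1 P ^ 2 * qT f 0 0 P
      - 2 * covec f 0 P * covec f 1 P * ((qT f 0 1 P + qT f 1 0 P) / 2)
      + covec f 0 P ^ 2 * qT f 1 1 P = 0

/-- The transversal plane `ξ² ω₁¹ - ξ¹ ω₁² = 0`, `ξ² ω₂¹ - ξ¹ ω₂² = 0` at `P`. -/
noncomputable def transversalPlane (ξ : Fin 2 → ℝ) (P : Space) : Submodule ℝ Space :=
  LinearMap.ker (ξ 1 • om1 f 0 P - ξ 0 • om1 f 1 P).toLinearMap ⊓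
    LinearMap.ker (ξ 1 • om2 f 0 P - ξ 0 • om2 f 1 P).toLinearMap

/-- The web is transversally geodesic on `U`: every transversal plane at every point is tangent
to a smooth surface all of whose tangent planes are transversal. -/
def IsTransversallyGeodesic (U : Set Space) : Prop :=
  ∀ P ∈ U, ∀ ξ : Fin 2 → ℝ, ξ ≠ 0 → ∃ (W : Set (Fin 2 → ℝ)) (φ : (Fin 2 → ℝ) → Space),
    IsOpen W ∧ (0 : Fin 2 → ℝ) ∈ W ∧ φ 0 = P ∧ Set.MapsTo φ W U ∧ ContDiffOn ℝ ∞ φ W ∧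
    LinearMap.range (fderiv ℝ φ 0).toLinearMap = transversalPlane f ξ P ∧
    ∀ w ∈ W, Function.Injective (fderiv ℝ φ w) ∧
      ∃ η : Fin 2 → ℝ, η ≠ 0 ∧
        LinearMap.range (fderiv ℝ φ w).toLinearMap = transversalPlane f η (φ w)

/-- The condition `bⁱ_(jkl) = δⁱ_(j b_kl)` on the curvature tensor at `P`. -/
def CurvatureCondition (P : Space) : Prop :=
  ∃ B : Fin 2 → Fin 2 → ℝ, ∀ i j k l : Fin 2,
    sym3 (fun j k l => curv f i j k l P) j k l =
      sym3 (fun j k l => (if i = j then 1 else 0) * B k l) j k l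

/-- Class **B**: the transversal `a`-distribution is not integrable; both the geometric
condition and the algebraic one fail. -/
def InClassB (U : Set Space) : Prop :=
  ¬ IsIntegrable 2 (transversalDist f) U ∧ ¬ ∀ P ∈ U, TransversalCondition f P

/-- Class **C**: the web is not transversally geodesic; both the geometric condition and the
algebraic one fail. -/
def InClassC (U : Set Space) : Prop :=
  ¬ IsTransversallyGeodesic f U ∧ ¬ ∀ P ∈ U, CurvatureCondition f P

/-- Class **E₁**. -/
def InClassE1 (U : Set Space) : Prop :=
  ∀ P ∈ U, covec f 0 P ≠ 0 ∧ covec f 1 P ≠ 0 ∧ covec f 0 P ≠ covec f 1 P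

/-- Class **E₁₁**, a subclass of **E₁**. -/
def InClassE11 (U : Set Space) : Prop :=
  InClassE1 f U ∧ ∀ P ∈ U, ∀ i, pT f i 1 P = 0 ∧ qT f i 0 P = 0

/-- Class **E₁₁₁**, a subclass of **E₁₁**. -/
def InClassE111 (U : Set Space) : Prop :=
  InClassE11 f U ∧ ∀ P ∈ U, pT f 1 0 P = -qT f 0 1 P

/-- Class **G₃**: `p = q ≠ 0`. -/
def InClassG3 (U : Set Space) : Prop :=
  ∀ P ∈ U, pAlt f P = qAlt f P ∧ pAlt f P ≠ 0

end Classes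

/-- The functions `u₃¹ = x¹ + y¹ + ½ (x¹)² y²`, `u₃² = x² + y² + ½ x¹ (y²)²`. -/
noncomputable def webMap (P : Space) : Fin 2 → ℝ :=
  ![P.1 0 + P.2 0 + (1 / 2) * P.1 0 ^ 2 * P.2 1, P.1 1 + P.2 1 + (1 / 2) * P.1 0 * P.2 1 ^ 2]

end ThreeWeb

open ThreeWeb

namespace ThreeWeb

open Filter Topology

/-! Write S = x¹, X = x², Y = y¹, T = y² and D = 1 + ST. All invariants of the web are rational
functions of S and T. The only mixed second derivatives are ∂²f/∂S∂T = (S, T), so only the Γⁱ₁₂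
survive, every connection form is a multiple of dS or dT, and a = (-T, S)/D². Since a is orthogonal
to (S, T), the connection terms cancel in ∇a, so ∇a = da. This gives p and q, and p₂₁ = -q₁₂ holds
identically. The criteria for G₃ and E₁₁₁ are then read off.

The positive integrability claims have explicit leaves. The form a₁ω₁¹ - a₂ω₂² equals -d log |D|, so
its leaves are ST = const (`isIntegrable_thetaDist_webMap`). Also ω₁ⁱ + ω₂ⁱ = dfⁱ, so the leaves are
level sets of fⁱ. Both sides of each equivalence in part 1 are thus true, and nothing general about
webs is needed.

The negative claims differentiate Pfaffian equations along a hypothetical integral surface: if ∑ gᵢ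
dhᵢ = 0 then ∑ dgᵢ ∧ dhᵢ = 0 (`sum_wedge_fderiv_eq_zero`). For the transversal a-distribution one
differentiation forces STD = 0. For a surface with transversal tangent planes of slope l = ξ²/ξ¹,
one differentiation determines dl (`fderiv_slope`), and a second gives lD + (T - Sl)² = 0
(`slope_eq`). This is a nontrivial polynomial condition on l, so some plane at every point is not
tangent to such a surface. The algebraic conditions in B and C fail by direct evaluation. -/

/-! ### Jacobian matrices, their inverses and the basis forms -/

theorem dx_apply (j : Fin 2) (v : Space) : dx j v = v.1 j := rfl

theorem dy_apply (j : Fin 2) (v : Space) : dy j v = v.2 j := rfl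

theorem hasFDerivAt_x (j : Fin 2) (P : Space) : HasFDerivAt (fun Q : Space => Q.1 j) (dx j) P :=
  (dx j).hasFDerivAt

theorem hasFDerivAt_y (j : Fin 2) (P : Space) : HasFDerivAt (fun Q : Space => Q.2 j) (dy j) P :=
  (dy j).hasFDerivAt

theorem hasFDerivAt_webMap_zero (P : Space) :
    HasFDerivAt (fun Q => webMap Q 0)
      ((1 + P.1 0 * P.2 1) • dx 0 + dy 0 + (P.1 0 ^ 2 / 2) • dy 1) P := by
  have h := ((hasFDerivAt_x 0 P).add (hasFDerivAt_y 0 P)).add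
    ((((hasFDerivAt_x 0 P).pow 2).const_mul (1 / 2)).mul (hasFDerivAt_y 1 P))
  refine h.congr_fderiv ?_
  refine ContinuousLinearMap.ext fun v => ?_
  simp [dx_apply, dy_apply]
  ring

theorem hasFDerivAt_webMap_one (P : Space) :
    HasFDerivAt (fun Q => webMap Q 1)
      ((P.2 1 ^ 2 / 2) • dx 0 + dx 1 + (1 + P.1 0 * P.2 1) • dy 1) P := by
  have h := ((hasFDerivAt_x 1 P).add (hasFDerivAt_y 1 P)).add
    (((hasFDerivAt_x 0 P).const_mul (1 / 2)).mul ((hasFDerivAt_y 1 P).pow 2))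
  refine h.congr_fderiv ?_
  refine ContinuousLinearMap.ext fun v => ?_
  simp [dx_apply, dy_apply]
  ring

theorem fBar_webMap (P : Space) :
    fBar webMap P = !![1 + P.1 0 * P.2 1, 0; P.2 1 ^ 2 / 2, 1] := by
  ext i j
  fin_cases i <;> fin_cases j <;>
    simp [fBar, ddx, (hasFDerivAt_webMap_zero P).fderiv, (hasFDerivAt_webMap_one P).fderiv,
      dx_apply, dy_apply]

theorem fTilde_webMap (P : Space) :
    fTilde webMap P = !![1, P.1 0 ^ 2 / 2; 0, 1 + P.1 0 * P.2 1] := by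
  ext i j
  fin_cases i <;> fin_cases j <;>
    simp [fTilde, ddy, (hasFDerivAt_webMap_zero P).fderiv, (hasFDerivAt_webMap_one P).fderiv,
      dx_apply, dy_apply]

theorem det_fBar_webMap (P : Space) : (fBar webMap P).det = 1 + P.1 0 * P.2 1 := by
  simp [fBar_webMap, Matrix.det_fin_two]

theorem det_fTilde_webMap (P : Space) : (fTilde webMap P).det = 1 + P.1 0 * P.2 1 := by
  simp [fTilde_webMap, Matrix.det_fin_two]

theorem fBar_webMap_inv (P : Space) :
    (fBar webMap P)⁻¹ =
      (1 + P.1 0 * P.2 1)⁻¹ • !![1, 0; -(P.2 1 ^ 2 / 2), 1 + P.1 0 * P.2 1] := by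
  rw [Matrix.inv_def, det_fBar_webMap, fBar_webMap, Matrix.adjugate_fin_two, Ring.inverse_eq_inv']
  simp

theorem fTilde_webMap_inv (P : Space) :
    (fTilde webMap P)⁻¹ =
      (1 + P.1 0 * P.2 1)⁻¹ • !![1 + P.1 0 * P.2 1, -(P.1 0 ^ 2 / 2); 0, 1] := by
  rw [Matrix.inv_def, det_fTilde_webMap, fTilde_webMap, Matrix.adjugate_fin_two,
    Ring.inverse_eq_inv']
  simp

theorem om1_webMap_zero (P : Space) : om1 webMap 0 P = (1 + P.1 0 * P.2 1) • dx 0 := by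
  simp [om1, fBar_webMap, Fin.sum_univ_two]

theorem om1_webMap_one (P : Space) : om1 webMap 1 P = (P.2 1 ^ 2 / 2) • dx 0 + dx 1 := by
  simp [om1, fBar_webMap, Fin.sum_univ_two]

theorem om2_webMap_zero (P : Space) : om2 webMap 0 P = dy 0 + (P.1 0 ^ 2 / 2) • dy 1 := by
  simp [om2, fTilde_webMap, Fin.sum_univ_two]

theorem om2_webMap_one (P : Space) : om2 webMap 1 P = (1 + P.1 0 * P.2 1) • dy 1 := by
  simp [om2, fTilde_webMap, Fin.sum_univ_two]

theorem hasFDerivAt_sq_div_two (P : Space) :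
    HasFDerivAt (fun Q : Space => Q.1 0 ^ 2 / 2) (P.1 0 • dx 0) P := by
  have h := ((hasFDerivAt_x 0 P).pow 2).const_mul (1 / 2)
  refine (h.congr_fderiv ?_).congr_of_eventuallyEq (.of_forall fun Q => ?_)
  · refine ContinuousLinearMap.ext fun v => ?_
    simp
    ring
  · simp only [one_div]
    ring

theorem hasFDerivAt_one_add_mul (P : Space) :
    HasFDerivAt (fun Q : Space => 1 + Q.1 0 * Q.2 1) (P.1 0 • dy 1 + P.2 1 • dx 0) P :=
  ((hasFDerivAt_x 0 P).mul (hasFDerivAt_y 1 P)).const_add 1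

/-! ### Connection and covector -/

theorem ddx_ddy_webMap_zero (l m : Fin 2) (P : Space) :
    ddx l (ddy m (fun Q => webMap Q 0)) P = if l = 0 ∧ m = 1 then P.1 0 else 0 := by
  have h : ddy m (fun Q => webMap Q 0) = fun Q => ![1, Q.1 0 ^ 2 / 2] m := by
    funext Q
    change fTilde webMap Q 0 m = _
    fin_cases m <;> simp [fTilde_webMap]
  rw [h, ddx]
  fin_cases m
  · simp
  · change fderiv ℝ (fun Q : Space => Q.1 0 ^ 2 / 2) P _ = _
    rw [(hasFDerivAt_sq_div_two P).fderiv]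
    fin_cases l <;> simp [dx_apply]

theorem ddx_ddy_webMap_one (l m : Fin 2) (P : Space) :
    ddx l (ddy m (fun Q => webMap Q 1)) P = if l = 0 ∧ m = 1 then P.2 1 else 0 := by
  have h : ddy m (fun Q => webMap Q 1) = fun Q => ![0, 1 + Q.1 0 * Q.2 1] m := by
    funext Q
    change fTilde webMap Q 1 m = _
    fin_cases m <;> simp [fTilde_webMap]
  rw [h, ddx]
  fin_cases m
  · simp
  · change fderiv ℝ (fun Q : Space => 1 + Q.1 0 * Q.2 1) P _ = _
    rw [(hasFDerivAt_one_add_mul P).fderiv]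
    fin_cases l <;> simp [dx_apply, dy_apply]

/-- The only nonzero coefficients `Γⁱ₁₂` are `-x¹/D²`, `-y²/D²` with `D = 1 + x¹y²`. -/
theorem Gam_webMap (i j k : Fin 2) (P : Space) :
    Gam webMap i j k P =
      if j = 0 ∧ k = 1 then -(![P.1 0, P.2 1] i / (1 + P.1 0 * P.2 1) ^ 2) else 0 := by
  fin_cases i <;> fin_cases j <;> fin_cases k <;>
    simp [Gam, Fin.sum_univ_two, ddx_ddy_webMap_zero, ddx_ddy_webMap_one, fBar_webMap_inv,
      fTilde_webMap_inv, div_eq_mul_inv, sq, mul_assoc]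

theorem covec_webMap_zero (P : Space) :
    covec webMap 0 P = -(P.2 1 / (1 + P.1 0 * P.2 1) ^ 2) := by
  simp [covec, torsion, Fin.sum_univ_two, Gam_webMap]; ring

theorem covec_webMap_one (P : Space) :
    covec webMap 1 P = P.1 0 / (1 + P.1 0 * P.2 1) ^ 2 := by
  simp [covec, torsion, Fin.sum_univ_two, Gam_webMap]; ring

/-- The junk value of division makes this true for D = 0 as well. Hence the formulas for the
connection forms and for `thetaForm` hold at every point of the space and can be differentiated as
identities of functions. -/
theorem div_sq_mul_mul (a D x : ℝ) : a / D ^ 2 * (D * x) = a / D * x := by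
  by_cases h : D = 0
  · simp [h]
  · field_simp

theorem conn_webMap_zero (i : Fin 2) (P : Space) :
    conn webMap 0 i P = (-(![P.1 0, P.2 1] i / (1 + P.1 0 * P.2 1))) • dy 1 := by
  refine ContinuousLinearMap.ext fun v => ?_
  simp [conn, Gam_webMap, om2_webMap_one, div_sq_mul_mul]

theorem conn_webMap_one (i : Fin 2) (P : Space) :
    conn webMap 1 i P = (-(![P.1 0, P.2 1] i / (1 + P.1 0 * P.2 1))) • dx 0 := by
  refine ContinuousLinearMap.ext fun v => ?_
  simp [conn, Gam_webMap, om1_webMap_zero, div_sq_mul_mul]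

theorem dx_frame1_webMap (m : Fin 2) (P : Space) :
    dx 0 (frame1 webMap m P) = if m = 0 then (1 + P.1 0 * P.2 1)⁻¹ else 0 := by
  fin_cases m <;> simp [dx_apply, frame1, fBar_webMap_inv]

theorem dy_frame1_webMap (j m : Fin 2) (P : Space) : dy j (frame1 webMap m P) = 0 := rfl

theorem dx_frame2_webMap (j m : Fin 2) (P : Space) : dx j (frame2 webMap m P) = 0 := rfl

theorem dy_frame2_webMap (m : Fin 2) (P : Space) :
    dy 1 (frame2 webMap m P) = if m = 1 then (1 + P.1 0 * P.2 1)⁻¹ else 0 := by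
  fin_cases m <;> simp [dy_apply, frame2, fTilde_webMap_inv]

theorem hasFDerivAt_div {g h : Space → ℝ} {g' h' : Space →L[ℝ] ℝ} {P : Space}
    (hg : HasFDerivAt g g' P) (hh : HasFDerivAt h h' P) (h0 : h P ≠ 0) :
    HasFDerivAt (fun Q => g Q / h Q) ((1 / h P) • g' - (g P / h P ^ 2) • h') P := by
  have hi := hg.mul ((hasDerivAt_inv h0).comp_hasFDerivAt P hh)
  refine (hi.congr_fderiv ?_).congr_of_eventuallyEq (.of_forall fun Q => div_eq_mul_inv _ _)
  refine ContinuousLinearMap.ext fun v => ?_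
  simp
  field_simp
  ring

theorem hasFDerivAt_x_div {P : Space} (hP : 1 + P.1 0 * P.2 1 ≠ 0) :
    HasFDerivAt (fun Q : Space => Q.1 0 / (1 + Q.1 0 * Q.2 1))
      ((1 / (1 + P.1 0 * P.2 1) ^ 2) • dx 0 - (P.1 0 ^ 2 / (1 + P.1 0 * P.2 1) ^ 2) • dy 1) P := by
  refine (hasFDerivAt_div (hasFDerivAt_x 0 P) (hasFDerivAt_one_add_mul P) hP).congr_fderiv ?_
  refine ContinuousLinearMap.ext fun v => ?_
  simp [dx_apply, dy_apply]
  field_simp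
  ring

theorem hasFDerivAt_y_div {P : Space} (hP : 1 + P.1 0 * P.2 1 ≠ 0) :
    HasFDerivAt (fun Q : Space => Q.2 1 / (1 + Q.1 0 * Q.2 1))
      ((1 / (1 + P.1 0 * P.2 1) ^ 2) • dy 1 - (P.2 1 ^ 2 / (1 + P.1 0 * P.2 1) ^ 2) • dx 0) P := by
  refine (hasFDerivAt_div (hasFDerivAt_y 1 P) (hasFDerivAt_one_add_mul P) hP).congr_fderiv ?_
  refine ContinuousLinearMap.ext fun v => ?_
  simp [dx_apply, dy_apply]
  field_simp
  ring

/-! ### Covariant differential of the covector -/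

theorem hasFDerivAt_covec_webMap_zero {P : Space} (hP : 1 + P.1 0 * P.2 1 ≠ 0) :
    HasFDerivAt (covec webMap 0)
      ((2 * P.2 1 ^ 2 / (1 + P.1 0 * P.2 1) ^ 3) • dx 0 +
        ((P.1 0 * P.2 1 - 1) / (1 + P.1 0 * P.2 1) ^ 3) • dy 1) P := by
  have h := (hasFDerivAt_div (hasFDerivAt_y 1 P) ((hasFDerivAt_one_add_mul P).pow 2)
    (pow_ne_zero 2 hP)).neg
  refine (h.congr_fderiv ?_).congr_of_eventuallyEq (.of_forall covec_webMap_zero)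
  refine ContinuousLinearMap.ext fun v => ?_
  simp [dx_apply, dy_apply]
  field_simp
  ring

theorem hasFDerivAt_covec_webMap_one {P : Space} (hP : 1 + P.1 0 * P.2 1 ≠ 0) :
    HasFDerivAt (covec webMap 1)
      (((1 - P.1 0 * P.2 1) / (1 + P.1 0 * P.2 1) ^ 3) • dx 0 -
        (2 * P.1 0 ^ 2 / (1 + P.1 0 * P.2 1) ^ 3) • dy 1) P := by
  have h := hasFDerivAt_div (hasFDerivAt_x 0 P) ((hasFDerivAt_one_add_mul P).pow 2) (pow_ne_zero 2 hP)
  refine (h.congr_fderiv ?_).congr_of_eventuallyEq (.of_forall covec_webMap_one)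
  refine ContinuousLinearMap.ext fun v => ?_
  simp [dx_apply, dy_apply]
  field_simp
  ring

/-- Here ∇a₁ = da₁: the forms ω₁ʲ are proportional to (S, T) in the index j and a is proportional to
(-T, S), so ∑ aⱼ ω₁ʲ = 0. -/
theorem nablaA_webMap_zero {P : Space} (hP : 1 + P.1 0 * P.2 1 ≠ 0) :
    nablaA webMap 0 P = (2 * P.2 1 ^ 2 / (1 + P.1 0 * P.2 1) ^ 3) • dx 0 +
        ((P.1 0 * P.2 1 - 1) / (1 + P.1 0 * P.2 1) ^ 3) • dy 1 := by
  refine ContinuousLinearMap.ext fun v => ?_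
  simp [nablaA, (hasFDerivAt_covec_webMap_zero hP).fderiv, covec_webMap_zero, covec_webMap_one,
    conn_webMap_zero]
  ring

theorem nablaA_webMap_one {P : Space} (hP : 1 + P.1 0 * P.2 1 ≠ 0) :
    nablaA webMap 1 P = ((1 - P.1 0 * P.2 1) / (1 + P.1 0 * P.2 1) ^ 3) • dx 0 -
        (2 * P.1 0 ^ 2 / (1 + P.1 0 * P.2 1) ^ 3) • dy 1 := by
  refine ContinuousLinearMap.ext fun v => ?_
  simp [nablaA, (hasFDerivAt_covec_webMap_one hP).fderiv, covec_webMap_zero, covec_webMap_one,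
    conn_webMap_one]
  ring

theorem pT_webMap_zero {P : Space} (hP : 1 + P.1 0 * P.2 1 ≠ 0) (j : Fin 2) :
    pT webMap 0 j P = if j = 0 then 2 * P.2 1 ^ 2 / (1 + P.1 0 * P.2 1) ^ 4 else 0 := by
  simp only [pT, nablaA_webMap_zero hP]
  fin_cases j <;> simp [dx_frame1_webMap, dy_frame1_webMap]
  field_simp

theorem pT_webMap_one {P : Space} (hP : 1 + P.1 0 * P.2 1 ≠ 0) (j : Fin 2) :
    pT webMap 1 j P = if j = 0 then (1 - P.1 0 * P.2 1) / (1 + P.1 0 * P.2 1) ^ 4 else 0 := by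
  simp only [pT, nablaA_webMap_one hP]
  fin_cases j <;> simp [dx_frame1_webMap, dy_frame1_webMap]
  field_simp

theorem qT_webMap_zero {P : Space} (hP : 1 + P.1 0 * P.2 1 ≠ 0) (j : Fin 2) :
    qT webMap 0 j P = if j = 1 then (P.1 0 * P.2 1 - 1) / (1 + P.1 0 * P.2 1) ^ 4 else 0 := by
  simp only [qT, nablaA_webMap_zero hP]
  fin_cases j <;> simp [dx_frame2_webMap, dy_frame2_webMap]
  field_simp

theorem qT_webMap_one {P : Space} (hP : 1 + P.1 0 * P.2 1 ≠ 0) (j : Fin 2) :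
    qT webMap 1 j P = if j = 1 then -(2 * P.1 0 ^ 2 / (1 + P.1 0 * P.2 1) ^ 4) else 0 := by
  simp only [qT, nablaA_webMap_one hP]
  fin_cases j <;> simp [dx_frame2_webMap, dy_frame2_webMap]
  field_simp

/-! ### Curvature -/

theorem fderiv_conn_webMap_zero {P : Space} (hP : 1 + P.1 0 * P.2 1 ≠ 0) (i : Fin 2)
    (u v : Space) :
    fderiv ℝ (conn webMap 0 i) P u v =
      -(![u.1 0 - P.1 0 ^ 2 * u.2 1, u.2 1 - P.2 1 ^ 2 * u.1 0] i /
        (1 + P.1 0 * P.2 1) ^ 2) * v.2 1 := by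
  fin_cases i
  · have h := ((hasFDerivAt_x_div hP).neg.smul_const (dy 1)).congr_of_eventuallyEq
      (.of_forall (conn_webMap_zero 0))
    simp [h.fderiv, dx_apply, dy_apply]
    ring
  · have h := ((hasFDerivAt_y_div hP).neg.smul_const (dy 1)).congr_of_eventuallyEq
      (.of_forall (conn_webMap_zero 1))
    simp [h.fderiv, dx_apply, dy_apply]
    ring

theorem fderiv_conn_webMap_one {P : Space} (hP : 1 + P.1 0 * P.2 1 ≠ 0) (i : Fin 2)
    (u v : Space) :
    fderiv ℝ (conn webMap 1 i) P u v =
      -(![u.1 0 - P.1 0 ^ 2 * u.2 1, u.2 1 - P.2 1 ^ 2 * u.1 0] i /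
        (1 + P.1 0 * P.2 1) ^ 2) * v.1 0 := by
  fin_cases i
  · have h := ((hasFDerivAt_x_div hP).neg.smul_const (dx 0)).congr_of_eventuallyEq
      (.of_forall (conn_webMap_one 0))
    simp [h.fderiv, dx_apply, dy_apply]
    ring
  · have h := ((hasFDerivAt_y_div hP).neg.smul_const (dx 0)).congr_of_eventuallyEq
      (.of_forall (conn_webMap_one 1))
    simp [h.fderiv, dx_apply, dy_apply]
    ring

/-- The only nonzero components of the curvature tensor are the `bⁱⱼ₁₂`. -/
theorem curv_webMap {P : Space} (hP : 1 + P.1 0 * P.2 1 ≠ 0) (i j k l : Fin 2) :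
    curv webMap i j k l P = if k = 0 ∧ l = 1 then
      !![P.1 0 * P.2 1 - 1, -(2 * P.1 0 ^ 2); 2 * P.2 1 ^ 2, 1 - P.1 0 * P.2 1] i j /
        (1 + P.1 0 * P.2 1) ^ 4 else 0 := by
  have h1 := dx_frame1_webMap k P
  have h2 := dy_frame1_webMap 1 k P
  have h3 := dx_frame2_webMap 0 l P
  have h4 := dy_frame2_webMap l P
  rw [dx_apply] at h1 h3
  rw [dy_apply] at h2 h4
  fin_cases j
  all_goals
    simp only [curv, extD, wedge, Fin.sum_univ_two, fderiv_conn_webMap_zero hP,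
      fderiv_conn_webMap_one hP, conn_webMap_zero, conn_webMap_one, Fin.zero_eta, Fin.mk_one,
      smul_apply, dx_apply, dy_apply, h1, h2, h3, h4, smul_eq_mul]
    fin_cases i <;> fin_cases k <;> fin_cases l <;> simp <;> field_simp <;> ring

/-- In the indices 1, 2: b¹₍₁₁₁₎ = 0 forces b₁₁ = 0, and then b²₍₁₁₂₎ = b₁₁/3 forces y² = 0. The
components b¹₍₁₁₂₎ and b²₍₁₂₂₎ must both equal (b₁₂ + b₂₁)/3, which forces x¹y² = 1. The two
conclusions are incompatible. -/
theorem not_curvatureCondition_webMap {P : Space} (hP : 1 + P.1 0 * P.2 1 ≠ 0) :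
    ¬ CurvatureCondition webMap P := by
  rintro ⟨B, hB⟩
  have h4 := pow_ne_zero 4 hP
  have a1 := hB 0 0 0 0
  have a2 := hB 1 0 0 1
  have a3 := hB 0 0 0 1
  have a4 := hB 1 0 1 1
  simp [sym3, curv_webMap hP] at a1 a2 a3 a4
  have e1 : 2 * P.2 1 ^ 2 / (1 + P.1 0 * P.2 1) ^ 4 = 0 := by linarith
  have e2 : (P.1 0 * P.2 1 - 1) / (1 + P.1 0 * P.2 1) ^ 4 =
      (1 - P.1 0 * P.2 1) / (1 + P.1 0 * P.2 1) ^ 4 := by linarith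
  rw [div_left_inj' h4] at e2
  have e3 : P.2 1 = 0 := by simpa [hP] using e1
  rw [e3] at e2
  norm_num at e2

/-! ### Pointwise conditions and the classes G₃ and E₁₁₁ -/

theorem contDiff_webMap : ContDiff ℝ ∞ webMap := by
  have hx (j : Fin 2) : ContDiff ℝ ∞ fun P : Space => P.1 j := (dx j).contDiff
  have hy (j : Fin 2) : ContDiff ℝ ∞ fun P : Space => P.2 j := (dy j).contDiff
  refine contDiff_pi.2 fun i => ?_
  fin_cases i
  · exact ((hx 0).add (hy 0)).add ((contDiff_const.mul ((hx 0).pow 2)).mul (hy 1))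
  · exact ((hx 1).add (hy 1)).add ((contDiff_const.mul (hx 0)).mul ((hy 1).pow 2))

theorem isThreeWeb_webMap {U : Set Space} (hU : IsOpen U)
    (h : ∀ P ∈ U, 1 + P.1 0 * P.2 1 ≠ 0) : IsThreeWeb webMap U :=
  ⟨hU, contDiff_webMap.contDiffOn, fun P hP => by
    rw [det_fBar_webMap, det_fTilde_webMap]; exact ⟨h P hP, h P hP⟩⟩

/-- The right-hand side is -d log |1 + x¹y²| where D is nonzero, which is why the form is closed
there. -/
theorem thetaForm_webMap (P : Space) :
    thetaForm webMap P = (-(P.2 1 / (1 + P.1 0 * P.2 1))) • dx 0 +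
      (-(P.1 0 / (1 + P.1 0 * P.2 1))) • dy 1 := by
  refine ContinuousLinearMap.ext fun v => ?_
  simp [thetaForm, covec_webMap_zero, covec_webMap_one, om1_webMap_zero, om2_webMap_one,
    div_sq_mul_mul]
  ring

theorem extD_thetaForm_webMap {P : Space} (hP : 1 + P.1 0 * P.2 1 ≠ 0) (u v : Space) :
    extD (thetaForm webMap) P u v = 0 := by
  have h := (((hasFDerivAt_y_div hP).neg.smul_const (dx 0)).add
    ((hasFDerivAt_x_div hP).neg.smul_const (dy 1))).congr_of_eventuallyEq
      (.of_forall thetaForm_webMap)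
  simp [extD, h.fderiv, dx_apply, dy_apply]
  ring

theorem wedge_nablaA_webMap {P : Space} (hP : 1 + P.1 0 * P.2 1 ≠ 0) :
    wedge (nablaA webMap 0 P) (om1 webMap 0 P) = wedge (nablaA webMap 1 P) (om2 webMap 1 P) := by
  funext u v
  simp [wedge, nablaA_webMap_zero hP, nablaA_webMap_one hP, om1_webMap_zero, om2_webMap_one]
  field_simp
  ring

theorem pT_eq_neg_qT_webMap {P : Space} (hP : 1 + P.1 0 * P.2 1 ≠ 0) :
    pT webMap 1 0 P = -qT webMap 0 1 P := by
  simp [pT_webMap_one hP, qT_webMap_zero hP]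
  ring

theorem pAlt_webMap {P : Space} (hP : 1 + P.1 0 * P.2 1 ≠ 0) :
    pAlt webMap P = (P.1 0 * P.2 1 - 1) / (2 * (1 + P.1 0 * P.2 1) ^ 4) := by
  simp [pAlt, pT_webMap_zero hP, pT_webMap_one hP]
  field_simp
  ring

theorem qAlt_webMap {P : Space} (hP : 1 + P.1 0 * P.2 1 ≠ 0) :
    qAlt webMap P = (P.1 0 * P.2 1 - 1) / (2 * (1 + P.1 0 * P.2 1) ^ 4) := by
  simp [qAlt, qT_webMap_zero hP, qT_webMap_one hP]
  field_simp

theorem inClassG3_webMap_iff {U : Set Space} (h : ∀ P ∈ U, 1 + P.1 0 * P.2 1 ≠ 0) :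
    InClassG3 webMap U ↔ ∀ P ∈ U, P.1 0 * P.2 1 ≠ 1 := by
  refine forall₂_congr fun P hP => ?_
  simp [pAlt_webMap (h P hP), qAlt_webMap (h P hP), h P hP, sub_eq_zero]

theorem pT_one_eq_zero_webMap {P : Space} (hP : 1 + P.1 0 * P.2 1 ≠ 0) (i : Fin 2) :
    pT webMap i 1 P = 0 ∧ qT webMap i 0 P = 0 := by
  fin_cases i <;> simp [pT_webMap_zero hP, pT_webMap_one hP, qT_webMap_zero hP, qT_webMap_one hP]

theorem inClassE111_webMap_iff {U : Set Space} (h : ∀ P ∈ U, 1 + P.1 0 * P.2 1 ≠ 0) :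
    InClassE111 webMap U ↔ ∀ P ∈ U, P.1 0 ≠ 0 ∧ P.2 1 ≠ 0 ∧ P.1 0 ≠ -P.2 1 := by
  have h2 : ∀ P ∈ U, ∀ i, pT webMap i 1 P = 0 ∧ qT webMap i 0 P = 0 :=
    fun P hP => pT_one_eq_zero_webMap (h P hP)
  have h3 : ∀ P ∈ U, pT webMap 1 0 P = -qT webMap 0 1 P :=
    fun P hP => pT_eq_neg_qT_webMap (h P hP)
  simp only [InClassE111, InClassE11, InClassE1, and_iff_left h2, and_iff_left h3]
  refine forall₂_congr fun P hP => ?_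
  rw [covec_webMap_zero, covec_webMap_one, ← neg_div, Ne, div_eq_zero_iff, Ne, div_eq_zero_iff, Ne,
    div_left_inj' (pow_ne_zero 2 (h P hP))]
  simp only [neg_eq_zero, pow_eq_zero_iff two_ne_zero, h P hP, or_false]
  constructor
  · exact fun ⟨a, b, c⟩ => ⟨b, a, fun e => c e.symm⟩
  · exact fun ⟨a, b, c⟩ => ⟨b, a, fun e => c e.symm⟩

/-! ### Explicit integral manifolds -/

theorem fderiv_fst_apply {k : ℕ} {φ : (Fin k → ℝ) → Space} {w : Fin k → ℝ}
    (h : DifferentiableAt ℝ φ w) (j : Fin 2) (v : Fin k → ℝ) :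
    fderiv ℝ (fun z => (φ z).1 j) w v = (fderiv ℝ φ w v).1 j := by
  have h' : HasFDerivAt (fun z => (φ z).1 j) ((dx j).comp (fderiv ℝ φ w)) w :=
    (dx j).hasFDerivAt.comp w h.hasFDerivAt
  rw [h'.fderiv]
  rfl

theorem fderiv_snd_apply {k : ℕ} {φ : (Fin k → ℝ) → Space} {w : Fin k → ℝ}
    (h : DifferentiableAt ℝ φ w) (j : Fin 2) (v : Fin k → ℝ) :
    fderiv ℝ (fun z => (φ z).2 j) w v = (fderiv ℝ φ w v).2 j := by
  have h' : HasFDerivAt (fun z => (φ z).2 j) ((dy j).comp (fderiv ℝ φ w)) w :=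
    (dy j).hasFDerivAt.comp w h.hasFDerivAt
  rw [h'.fderiv]
  rfl

/-- A distribution is integrable if it has integral manifolds parametrized by all of `ℝᵏ`, as
long as they stay in `U`. -/
theorem isIntegrable_of_param {k : ℕ} {D : Space → Submodule ℝ Space} {U : Set Space}
    (hU : IsOpen U)
    (h : ∀ P ∈ U, ∃ φ : (Fin k → ℝ) → Space, φ 0 = P ∧ ContDiff ℝ ∞ φ ∧ ∀ w, φ w ∈ U →
      Function.Injective (fderiv ℝ φ w) ∧ LinearMap.range (fderiv ℝ φ w).toLinearMap = D (φ w)) :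
    IsIntegrable k D U := by
  intro P hP
  obtain ⟨φ, h0, hφ, H⟩ := h P hP
  exact ⟨φ ⁻¹' U, φ, hU.preimage hφ.continuous, by simpa [h0] using hP, h0, fun w hw => hw,
    hφ.contDiffOn, H⟩

theorem injective_and_range_eq {k : ℕ} {A : (Fin k → ℝ) →L[ℝ] Space} {K : Submodule ℝ Space}
    (B : Space → Fin k → ℝ) (h1 : ∀ v, B (A v) = v) (h2 : ∀ v, A v ∈ K)
    (h3 : ∀ z ∈ K, A (B z) = z) :
    Function.Injective A ∧ LinearMap.range A.toLinearMap = K := by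
  refine ⟨Function.LeftInverse.injective h1, le_antisymm ?_ fun z hz => ⟨B z, h3 z hz⟩⟩
  rintro _ ⟨v, rfl⟩
  exact h2 v

theorem contDiff_mk {k : ℕ} {a b c d : (Fin k → ℝ) → ℝ} (ha : ContDiff ℝ ∞ a)
    (hb : ContDiff ℝ ∞ b) (hc : ContDiff ℝ ∞ c) (hd : ContDiff ℝ ∞ d) :
    ContDiff ℝ ∞ fun w => ((![a w, b w], ![c w, d w]) : Space) := by
  refine ContDiff.prodMk (contDiff_pi.2 fun i => ?_) (contDiff_pi.2 fun i => ?_) <;>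
    fin_cases i <;> assumption

theorem fderiv_mk {k : ℕ} {a b c d : (Fin k → ℝ) → ℝ} {a' b' c' d' : (Fin k → ℝ) →L[ℝ] ℝ}
    {w : Fin k → ℝ} (ha : HasFDerivAt a a' w) (hb : HasFDerivAt b b' w) (hc : HasFDerivAt c c' w)
    (hd : HasFDerivAt d d' w) (v : Fin k → ℝ) :
    fderiv ℝ (fun w => ((![a w, b w], ![c w, d w]) : Space)) w v =
      (![a' v, b' v], ![c' v, d' v]) := by
  have h1 : HasFDerivAt (fun w => ![a w, b w])
      (ContinuousLinearMap.pi ![a', b']) w := by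
    refine hasFDerivAt_pi.2 fun i => ?_
    fin_cases i <;> assumption
  have h2 : HasFDerivAt (fun w => ![c w, d w])
      (ContinuousLinearMap.pi ![c', d']) w := by
    refine hasFDerivAt_pi.2 fun i => ?_
    fin_cases i <;> assumption
  rw [(h1.prodMk h2).fderiv]
  refine Prod.ext ?_ ?_ <;> funext i <;> fin_cases i <;> rfl

theorem space_eq_mk (z : Space) : z = (![z.1 0, z.1 1], ![z.2 0, z.2 1]) := by
  refine Prod.ext ?_ ?_ <;> funext i <;> fin_cases i <;> rfl

theorem contDiff_coord {k : ℕ} (i : Fin k) : ContDiff ℝ ∞ fun w : Fin k → ℝ => w i :=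
  contDiff_apply ℝ ℝ i

theorem hasFDerivAt_coord {k : ℕ} (i : Fin k) (w : Fin k → ℝ) :
    HasFDerivAt (fun w : Fin k → ℝ => w i)
      (ContinuousLinearMap.proj i : (Fin k → ℝ) →L[ℝ] ℝ) w :=
  hasFDerivAt_apply i w

theorem mem_thetaDist_webMap {P : Space} (hP : 1 + P.1 0 * P.2 1 ≠ 0) (z : Space) :
    z ∈ thetaDist webMap P ↔ P.2 1 * z.1 0 + P.1 0 * z.2 1 = 0 := by
  have : thetaForm webMap P z = -(P.2 1 * z.1 0 + P.1 0 * z.2 1) / (1 + P.1 0 * P.2 1) := by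
    simp [thetaForm_webMap, dx_apply, dy_apply]
    ring
  rw [thetaDist, LinearMap.mem_ker, ContinuousLinearMap.coe_coe, this, div_eq_zero_iff]
  simp only [hP, or_false, neg_eq_zero]

/-- The leaves are the hypersurfaces x¹y² = const. The flow (S eʷ, T e⁻ʷ) parametrizes them
regularly even on the axes, provided (S, T) ≠ 0, which is what a ≠ 0 means. -/
theorem isIntegrable_thetaDist_webMap {U : Set Space} (hU : IsOpen U)
    (h : ∀ P ∈ U, 1 + P.1 0 * P.2 1 ≠ 0) (ha : ∀ P ∈ U, ∃ i, covec webMap i P ≠ 0) :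
    IsIntegrable 3 (thetaDist webMap) U := by
  refine isIntegrable_of_param hU fun P hP => ?_
  have hne : P.1 0 ≠ 0 ∨ P.2 1 ≠ 0 := by
    by_contra! hc
    obtain ⟨i, hi⟩ := ha P hP
    fin_cases i <;> simp [covec_webMap_zero, covec_webMap_one, hc.1, hc.2] at hi
  refine ⟨fun w => (![P.1 0 * Real.exp (w 0), P.1 1 + w 1],
    ![P.2 0 + w 2, P.2 1 * Real.exp (-w 0)]), ?_, ?_, fun w hw => ?_⟩
  · simpa using (space_eq_mk P).symm
  · exact contDiff_mk (contDiff_const.mul (contDiff_coord 0).exp)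
      (contDiff_const.add (contDiff_coord 1)) (contDiff_const.add (contDiff_coord 2))
      (contDiff_const.mul (contDiff_coord 0).neg.exp)
  · have hd := fderiv_mk ((hasFDerivAt_coord 0 w).exp.const_mul (P.1 0))
      ((hasFDerivAt_coord 1 w).const_add (P.1 1)) ((hasFDerivAt_coord 2 w).const_add (P.2 0))
      ((hasFDerivAt_coord 0 w).neg.exp.const_mul (P.2 1))
    simp only [Pi.neg_apply] at hd
    have hD := h _ hw
    simp only [Matrix.cons_val_zero, Matrix.cons_val_one] at hD
    set s := P.1 0 * Real.exp (w 0) with hs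
    set t := P.2 1 * Real.exp (-w 0) with ht
    have hst : s ^ 2 + t ^ 2 ≠ 0 := by
      rcases hne with h0 | h0
      · have : s ≠ 0 := mul_ne_zero h0 (Real.exp_ne_zero _)
        positivity
      · have : t ≠ 0 := mul_ne_zero h0 (Real.exp_ne_zero _)
        positivity
    have hd' (v : Fin 3 → ℝ) : fderiv ℝ (fun w : Fin 3 → ℝ =>
        ((![P.1 0 * Real.exp (w 0), P.1 1 + w 1],
          ![P.2 0 + w 2, P.2 1 * Real.exp (-w 0)]) : Space)) w v =
        (![s * v 0, v 1], ![v 2, -(t * v 0)]) := by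
      rw [hd]
      simp [hs, ht, mul_assoc]
    -- The first entry is the coefficient of the projection onto the direction (s, -t), tangent to
    -- the curve ST = const.
    refine injective_and_range_eq
      (fun z => ![(s * z.1 0 - t * z.2 1) / (s ^ 2 + t ^ 2), z.1 1, z.2 0])
      (fun v => ?_) (fun v => ?_) (fun z hz => ?_)
    · rw [hd']
      funext i
      fin_cases i <;> simp
      field_simp
    · rw [hd', mem_thetaDist_webMap hD]
      simp
      ring
    · rw [mem_thetaDist_webMap hD] at hz
      simp only [Matrix.cons_val_zero, Matrix.cons_val_one] at hz
      rw [hd']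
      conv_rhs => rw [space_eq_mk z]
      have e1 : s * ((s * z.1 0 - t * z.2 1) / (s ^ 2 + t ^ 2)) = z.1 0 := by
        field_simp
        linear_combination -t * hz
      have e2 : -(t * ((s * z.1 0 - t * z.2 1) / (s ^ 2 + t ^ 2))) = z.2 1 := by
        field_simp
        linear_combination -s * hz
      simp [e1, e2]

theorem mem_sumDist_webMap_zero (P z : Space) : z ∈ sumDist webMap 0 P ↔
    (1 + P.1 0 * P.2 1) * z.1 0 + (z.2 0 + P.1 0 ^ 2 / 2 * z.2 1) = 0 := by
  rw [sumDist, LinearMap.mem_ker, om1_webMap_zero, om2_webMap_zero]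
  rfl

theorem mem_sumDist_webMap_one (P z : Space) : z ∈ sumDist webMap 1 P ↔
    P.2 1 ^ 2 / 2 * z.1 0 + z.1 1 + (1 + P.1 0 * P.2 1) * z.2 1 = 0 := by
  rw [sumDist, LinearMap.mem_ker, om1_webMap_one, om2_webMap_one]
  rfl

/-- Since ω₁¹ + ω₂¹ = df¹, the leaves are the level sets of f¹, which are graphs after solving for
y¹. -/
theorem isIntegrable_sumDist_webMap_zero {U : Set Space} (hU : IsOpen U) :
    IsIntegrable 3 (sumDist webMap 0) U := by
  refine isIntegrable_of_param hU fun P hP => ?_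
  refine ⟨fun w => (![P.1 0 + w 0, P.1 1 + w 1],
    ![webMap P 0 - (P.1 0 + w 0) - 1 / 2 * (P.1 0 + w 0) ^ 2 * (P.2 1 + w 2), P.2 1 + w 2]),
    ?_, ?_, fun w hw => ?_⟩
  · conv_rhs => rw [space_eq_mk P]
    simp [webMap]
    ring
  · exact contDiff_mk (contDiff_const.add (contDiff_coord 0))
      (contDiff_const.add (contDiff_coord 1)) ((contDiff_const.sub
        (contDiff_const.add (contDiff_coord 0))).sub ((contDiff_const.mul
        ((contDiff_const.add (contDiff_coord 0)).pow 2)).mul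
        (contDiff_const.add (contDiff_coord 2)))) (contDiff_const.add (contDiff_coord 2))
  · have h0 := (hasFDerivAt_coord 0 w).const_add (P.1 0)
    have h2 := (hasFDerivAt_coord 2 w).const_add (P.2 1)
    have hd := fderiv_mk h0 ((hasFDerivAt_coord 1 w).const_add (P.1 1))
      ((h0.const_sub (webMap P 0)).sub (((h0.pow 2).const_mul (1 / 2)).mul h2)) h2
    simp only [Pi.mul_apply, Pi.sub_apply] at hd
    refine injective_and_range_eq (fun z => ![z.1 0, z.1 1, z.2 1])
      (fun v => ?_) (fun v => ?_) (fun z hz => ?_)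
    · rw [hd]
      funext i
      fin_cases i <;> simp
    · rw [hd, mem_sumDist_webMap_zero]
      simp
      ring
    · rw [mem_sumDist_webMap_zero] at hz
      simp only [Matrix.cons_val_zero, Matrix.cons_val_one] at hz
      rw [hd]
      conv_rhs => rw [space_eq_mk z]
      simp
      linear_combination -hz

/-- The leaves are the level sets of f², written as graphs by solving for x². -/
theorem isIntegrable_sumDist_webMap_one {U : Set Space} (hU : IsOpen U) :
    IsIntegrable 3 (sumDist webMap 1) U := by
  refine isIntegrable_of_param hU fun P hP => ?_
  refine ⟨fun w => (![P.1 0 + w 0,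
    webMap P 1 - (P.2 1 + w 2) - 1 / 2 * (P.1 0 + w 0) * (P.2 1 + w 2) ^ 2],
    ![P.2 0 + w 1, P.2 1 + w 2]), ?_, ?_, fun w hw => ?_⟩
  · conv_rhs => rw [space_eq_mk P]
    simp [webMap]
    ring
  · exact contDiff_mk (contDiff_const.add (contDiff_coord 0))
      ((contDiff_const.sub
        (contDiff_const.add (contDiff_coord 2))).sub ((contDiff_const.mul
        (contDiff_const.add (contDiff_coord 0))).mul
        ((contDiff_const.add (contDiff_coord 2)).pow 2)))
      (contDiff_const.add (contDiff_coord 1)) (contDiff_const.add (contDiff_coord 2))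
  · have h0 := (hasFDerivAt_coord 0 w).const_add (P.1 0)
    have h2 := (hasFDerivAt_coord 2 w).const_add (P.2 1)
    have hd := fderiv_mk h0 ((h2.const_sub (webMap P 1)).sub ((h0.const_mul (1 / 2)).mul
      (h2.pow 2))) ((hasFDerivAt_coord 1 w).const_add (P.2 0)) h2
    simp only [Pi.mul_apply, Pi.sub_apply] at hd
    refine injective_and_range_eq (fun z => ![z.1 0, z.2 0, z.2 1])
      (fun v => ?_) (fun v => ?_) (fun z hz => ?_)
    · rw [hd]
      funext i
      fin_cases i <;> simp
    · rw [hd, mem_sumDist_webMap_one]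
      simp
      ring
    · rw [mem_sumDist_webMap_one] at hz
      simp only [Matrix.cons_val_zero, Matrix.cons_val_one] at hz
      rw [hd]
      conv_rhs => rw [space_eq_mk z]
      simp
      linear_combination -hz

/-! ### Density of the generic points -/

theorem dense_generic : Dense {P : Space | 1 + P.1 0 * P.2 1 ≠ 0 ∧ P.1 0 * P.2 1 ≠ 1 ∧
      P.1 0 ≠ 0 ∧ P.2 1 ≠ 0 ∧ P.1 0 ≠ -P.2 1} := by
  rw [dense_iff_inter_open]
  rintro U hU ⟨P, hP⟩
  set s := P.1 0
  set t := P.2 1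
  let γ : ℝ → Space := fun τ => P + τ • ((Pi.single 0 1, Pi.single 1 1) : Space)
  have hγ : Continuous γ := by fun_prop
  -- Along the line through P on which x¹ and y² grow at equal speed, the product of the five
  -- excluded quantities is this polynomial in τ. It is nonzero, so arbitrarily small τ avoid its
  -- finitely many roots.
  let Q : Polynomial ℝ := (1 + (.X + .C s) * (.X + .C t)) * ((.X + .C s) * (.X + .C t) - 1) *
    (.X + .C s) * (.X + .C t) * (2 * .X + .C (s + t))
  have hQ : Q ≠ 0 := by
    have aux (R : Polynomial ℝ) (τ : ℝ) (h : R.eval τ ≠ 0) : R ≠ 0 := by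
      rintro rfl
      simp at h
    refine mul_ne_zero (mul_ne_zero (mul_ne_zero (mul_ne_zero ?_ ?_) ?_) ?_) ?_
    · exact aux _ (-s) (by simp)
    · exact aux _ (-s) (by simp)
    · exact aux _ (1 - s) (by simp)
    · exact aux _ (1 - t) (by simp)
    · exact aux _ ((1 - s - t) / 2) (by
        have : 2 * ((1 - s - t) / 2) + (s + t) = 1 := by ring
        simp only [Polynomial.eval_add, Polynomial.eval_mul, Polynomial.eval_ofNat,
          Polynomial.eval_X, Polynomial.eval_C, this]
        exact one_ne_zero)
  obtain ⟨τ, hτ, hτU⟩ := ((Polynomial.finite_setOfPred_isRoot hQ).countable.dense_compl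
    ℝ).exists_mem_open (hU.preimage hγ) ⟨0, by
    change γ 0 ∈ U
    simpa only [γ, zero_smul, add_zero] using hP⟩
  have h1 : (γ τ).1 0 = τ + s := by simp [γ, s, add_comm]
  have h2 : (γ τ).2 1 = τ + t := by simp [γ, t, add_comm]
  refine ⟨γ τ, hτU, ?_⟩
  simp only [Set.mem_compl_iff, Set.mem_ofPred_eq, Polynomial.IsRoot.def, Q, Polynomial.eval_mul,
    Polynomial.eval_add, Polynomial.eval_sub, Polynomial.eval_one, Polynomial.eval_X,
    Polynomial.eval_C, Polynomial.eval_ofNat, mul_eq_zero, not_or] at hτ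
  obtain ⟨⟨⟨⟨a, b⟩, c⟩, d⟩, e⟩ := hτ
  simp only [Set.mem_ofPred_eq, h1, h2]
  exact ⟨a, fun h => b (by linarith), c, d, fun h => e (by linarith)⟩

/-! ### Differentiating Pfaffian equations; failure of integrability of the a-distribution -/

/-- If `∑ gᵢ dhᵢ` vanishes near a point, then so does `∑ dgᵢ ∧ dhᵢ` at this point. -/
theorem sum_wedge_fderiv_eq_zero {k n : ℕ} {g h : Fin n → (Fin k → ℝ) → ℝ}
    {g' : Fin n → (Fin k → ℝ) →L[ℝ] ℝ} {w : Fin k → ℝ} (hg : ∀ i, HasFDerivAt (g i) (g' i) w)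
    (hh : ∀ i, ContDiffAt ℝ ∞ (h i) w)
    (H : ∀ᶠ z in 𝓝 w, ∀ v, ∑ i, g i z * fderiv ℝ (h i) z v = 0) (u v : Fin k → ℝ) :
    ∑ i, (g' i u * fderiv ℝ (h i) w v - g' i v * fderiv ℝ (h i) w u) = 0 := by
  have h2 (i : Fin n) : DifferentiableAt ℝ (fderiv ℝ (h i)) w :=
    ((hh i).fderiv_right (m := 1) (by norm_cast)).differentiableAt one_ne_zero
  -- This is the derivative in the direction u of the equation evaluated on the constant vector v.
  -- Antisymmetrizing in u, v removes the second derivatives of the hᵢ by their symmetry.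
  have key (u v : Fin k → ℝ) : ∑ i, (g i w * fderiv ℝ (fderiv ℝ (h i)) w u v +
      fderiv ℝ (h i) w v * g' i u) = 0 := by
    have hd : HasFDerivAt (fun z => ∑ i, g i z * fderiv ℝ (h i) z v) _ w :=
      HasFDerivAt.fun_sum fun i _ => (hg i).mul
        ((h2 i).hasFDerivAt.clm_apply (hasFDerivAt_const v w))
    have h0 : HasFDerivAt (fun z => ∑ i, g i z * fderiv ℝ (h i) z v)
        (0 : (Fin k → ℝ) →L[ℝ] ℝ) w :=
      (hasFDerivAt_const (0 : ℝ) w).congr_of_eventuallyEq (H.mono fun z hz => hz v)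
    have := congrArg (fun A : (Fin k → ℝ) →L[ℝ] ℝ => A u) (hd.unique h0)
    simpa using this
  have hs (i : Fin n) : fderiv ℝ (fderiv ℝ (h i)) w u v = fderiv ℝ (fderiv ℝ (h i)) w v u :=
    (hh i).isSymmSndFDerivAt (by
      rw [minSmoothness_of_isRCLikeNormedField]
      norm_cast) u v
  have := congrArg₂ (· - ·) (key u v) (key v u)
  simp only [sub_zero, ← Finset.sum_sub_distrib] at this
  rw [← this]
  refine Finset.sum_congr rfl fun i _ => ?_
  rw [hs i]
  ring

theorem contDiffAt_coord_of_contDiffOn {k : ℕ} {φ : (Fin k → ℝ) → Space} {W : Set (Fin k → ℝ)}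
    (hW : IsOpen W) (hφ : ContDiffOn ℝ ∞ φ W) {w : Fin k → ℝ} (hw : w ∈ W) (j : Fin 2) :
    ContDiffAt ℝ ∞ (fun z => (φ z).1 j) w ∧ ContDiffAt ℝ ∞ (fun z => (φ z).2 j) w := by
  have h := hφ.contDiffAt (hW.mem_nhds hw)
  exact ⟨(dx j).contDiff.contDiffAt.comp w h, (dy j).contDiff.contDiffAt.comp w h⟩

theorem mem_transversalDist_webMap {P : Space} (hP : 1 + P.1 0 * P.2 1 ≠ 0) (z : Space) :
    z ∈ transversalDist webMap P ↔
      P.1 0 * z.1 1 - (P.2 1 + P.1 0 * P.2 1 ^ 2 / 2) * z.1 0 = 0 ∧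
        (P.1 0 + P.1 0 ^ 2 * P.2 1 / 2) * z.2 1 - P.2 1 * z.2 0 = 0 := by
  have h1 : (covec webMap 0 P • om1 webMap 0 P + covec webMap 1 P • om1 webMap 1 P) z =
      (P.1 0 * z.1 1 - (P.2 1 + P.1 0 * P.2 1 ^ 2 / 2) * z.1 0) /
        (1 + P.1 0 * P.2 1) ^ 2 := by
    simp [covec_webMap_zero, covec_webMap_one, om1_webMap_zero, om1_webMap_one, dx_apply]
    ring
  have h2 : (covec webMap 0 P • om2 webMap 0 P + covec webMap 1 P • om2 webMap 1 P) z =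
      ((P.1 0 + P.1 0 ^ 2 * P.2 1 / 2) * z.2 1 - P.2 1 * z.2 0) /
        (1 + P.1 0 * P.2 1) ^ 2 := by
    simp [covec_webMap_zero, covec_webMap_one, om2_webMap_zero, om2_webMap_one, dy_apply]
    ring
  rw [transversalDist, Submodule.mem_inf, LinearMap.mem_ker, LinearMap.mem_ker,
    ContinuousLinearMap.coe_coe, ContinuousLinearMap.coe_coe, h1, h2]
  simp [hP]

/-- On an integral surface S dX = (T + ST²/2) dS. The exterior derivative of this equation,
evaluated on a tangent vector u along y = const and a tangent vector v along x = const, gives ST(1 +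
ST) = 0. -/
theorem not_isIntegrable_transversalDist_webMap {U : Set Space}
    (h : ∀ P ∈ U, 1 + P.1 0 * P.2 1 ≠ 0) {P : Space} (hP : P ∈ U) (hs : P.1 0 ≠ 0)
    (ht : P.2 1 ≠ 0) : ¬ IsIntegrable 2 (transversalDist webMap) U := by
  intro hI
  obtain ⟨W, φ, hW, h0, rfl, hWU, hφ, H⟩ := hI P hP
  have hd (w) (hw : w ∈ W) : DifferentiableAt ℝ φ w :=
    (hφ.contDiffAt (hW.mem_nhds hw)).differentiableAt (by simp)
  have hT := ((contDiffAt_coord_of_contDiffOn hW hφ h0 1).2).differentiableAt (by simp)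
  have hS := (contDiffAt_coord_of_contDiffOn hW hφ h0 0).1
  have hX := (contDiffAt_coord_of_contDiffOn hW hφ h0 1).1
  have hS' := hS.differentiableAt (by simp)
  obtain ⟨u, hu⟩ : ((![(φ 0).1 0, (φ 0).2 1 + (φ 0).1 0 * (φ 0).2 1 ^ 2 / 2], 0) : Space) ∈
      LinearMap.range (fderiv ℝ φ 0).toLinearMap := by
    rw [(H 0 h0).2, mem_transversalDist_webMap (h _ hP)]
    simp
    ring
  obtain ⟨v, hv⟩ :
      ((0, ![(φ 0).1 0 + (φ 0).1 0 ^ 2 * (φ 0).2 1 / 2, (φ 0).2 1]) : Space) ∈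
      LinearMap.range (fderiv ℝ φ 0).toLinearMap := by
    rw [(H 0 h0).2, mem_transversalDist_webMap (h _ hP)]
    simp
    ring
  rw [ContinuousLinearMap.coe_coe] at hu hv
  have hG := (hT.hasFDerivAt.add ((hS'.hasFDerivAt.mul (hT.hasFDerivAt.pow 2)).mul_const
    (1 / 2))).neg
  have key := sum_wedge_fderiv_eq_zero (w := 0) (g := ![fun z => (φ z).1 0, _]) (g' := ![_, _])
    (h := ![fun z => (φ z).1 1, fun z => (φ z).1 0])
    (by
      intro i
      fin_cases i
      · exact hS'.hasFDerivAt
      · exact hG)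
    (by
      intro i
      fin_cases i
      · exact hX
      · exact hS)
    (by
      filter_upwards [hW.mem_nhds h0] with w hw v
      have : fderiv ℝ φ w v ∈ transversalDist webMap (φ w) := by
        rw [← (H w hw).2]
        exact ⟨v, rfl⟩
      rw [mem_transversalDist_webMap (h _ (hWU hw))] at this
      simp [fderiv_fst_apply (hd w hw)]
      linear_combination this.1) u v
  simp [fderiv_fst_apply (hd 0 h0), fderiv_snd_apply (hd 0 h0), hu, hv, hs] at key
  have : (φ 0).1 0 * (φ 0).2 1 * (1 + (φ 0).1 0 * (φ 0).2 1) = 0 := by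
    linear_combination -(φ 0).1 0 * key
  simp [hs, ht, h _ hP] at this

/-- The q-condition already fails: its left-hand side is -ST(1 + ST)/D⁸. -/
theorem not_transversalCondition_webMap {P : Space} (hP : 1 + P.1 0 * P.2 1 ≠ 0)
    (hs : P.1 0 ≠ 0) (ht : P.2 1 ≠ 0) : ¬ TransversalCondition webMap P := by
  rintro ⟨-, h⟩
  simp [covec_webMap_zero, covec_webMap_one, qT_webMap_zero hP, qT_webMap_one hP] at h
  have : P.1 0 * P.2 1 * (1 + P.1 0 * P.2 1) = 0 := by
    generalize hD : 1 + P.1 0 * P.2 1 = D at *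
    field_simp at h
    linear_combination -h - P.1 0 * P.2 1 * hD
  simp [hs, ht, hP] at this

/-! ### Failure of transversal geodesicity -/

theorem fderiv_apply_eq_fin_two {g : (Fin 2 → ℝ) → ℝ} (w v : Fin 2 → ℝ) :
    fderiv ℝ g w v = v 0 * fderiv ℝ g w (Pi.single 0 1) + v 1 * fderiv ℝ g w (Pi.single 1 1) := by
  conv_lhs => rw [← Finset.univ_sum_single v, Fin.sum_univ_two]
  have (i : Fin 2) : (Pi.single i (v i) : Fin 2 → ℝ) = v i • Pi.single i 1 := by
    rw [← Pi.single_smul, smul_eq_mul, mul_one]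
  rw [this, this, map_add, map_smul, map_smul, smul_eq_mul, smul_eq_mul]

/-- A surface with transversal tangent planes of slope `l` (in the coordinates `S`, `X`, `Y`, `T` of
the surface): the slope satisfies `D dl = (T l - S l²) dS + (T - S l) dT`. -/
theorem fderiv_slope {S T X Y l : (Fin 2 → ℝ) → ℝ} {w : Fin 2 → ℝ}
    (hS : ContDiffAt ℝ ∞ S w) (hT : ContDiffAt ℝ ∞ T w) (hX : ContDiffAt ℝ ∞ X w)
    (hY : ContDiffAt ℝ ∞ Y w) (hl : ContDiffAt ℝ ∞ l w)
    (hJ : fderiv ℝ S w (Pi.single 0 1) * fderiv ℝ T w (Pi.single 1 1) -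
      fderiv ℝ S w (Pi.single 1 1) * fderiv ℝ T w (Pi.single 0 1) ≠ 0)
    (h1 : ∀ᶠ z in 𝓝 w, ∀ v, fderiv ℝ X z v =
      (l z * (1 + S z * T z) - T z ^ 2 / 2) * fderiv ℝ S z v)
    (h2 : ∀ᶠ z in 𝓝 w, ∀ v, l z * fderiv ℝ Y z v =
      (1 + S z * T z - l z * (S z ^ 2 / 2)) * fderiv ℝ T z v) (v : Fin 2 → ℝ) :
    (1 + S w * T w) * fderiv ℝ l w v = (T w * l w - S w * l w ^ 2) * fderiv ℝ S w v +
      (T w - S w * l w) * fderiv ℝ T w v := by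
  have hS' := (hS.differentiableAt (by simp)).hasFDerivAt
  have hT' := (hT.differentiableAt (by simp)).hasFDerivAt
  have hl' := (hl.differentiableAt (by simp)).hasFDerivAt
  have hD := (hS'.mul hT').const_add 1
  have hG1 := (hl'.mul hD).sub ((hT'.pow 2).mul_const (1 / 2))
  have hG2 := (hD.sub (hl'.mul ((hS'.pow 2).mul_const (1 / 2)))).neg
  have k1 := sum_wedge_fderiv_eq_zero (w := w) (g := ![fun _ => -1, _]) (g' := ![_, _]) (h := ![X, S])
    (by
      intro i
      fin_cases i
      · exact hasFDerivAt_const _ _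
      · exact hG1)
    (by
      intro i
      fin_cases i
      · exact hX
      · exact hS)
    (by
      filter_upwards [h1] with z hz v
      simp [hz v]
      ring) (Pi.single 0 1) (Pi.single 1 1)
  have k2 := sum_wedge_fderiv_eq_zero (w := w) (g := ![l, _]) (g' := ![_, _]) (h := ![Y, T])
    (by
      intro i
      fin_cases i
      · exact hl'
      · exact hG2)
    (by
      intro i
      fin_cases i
      · exact hY
      · exact hT)
    (by
      filter_upwards [h2] with z hz v
      simp [hz v]
      ring) (Pi.single 0 1) (Pi.single 1 1)
  have y0 := h2.self_of_nhds (Pi.single 0 1)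
  have y1 := h2.self_of_nhds (Pi.single 1 1)
  simp at k1
  simp at k2
  rw [fderiv_apply_eq_fin_two (g := l), fderiv_apply_eq_fin_two (g := S),
    fderiv_apply_eq_fin_two (g := T)]
  generalize fderiv ℝ S w (Pi.single 0 1) = s0 at *
  generalize fderiv ℝ S w (Pi.single 1 1) = s1 at *
  generalize fderiv ℝ T w (Pi.single 0 1) = t0 at *
  generalize fderiv ℝ T w (Pi.single 1 1) = t1 at *
  generalize fderiv ℝ l w (Pi.single 0 1) = l0 at *
  generalize fderiv ℝ l w (Pi.single 1 1) = l1 at *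
  generalize fderiv ℝ Y w (Pi.single 0 1) = Y0 at *
  generalize fderiv ℝ Y w (Pi.single 1 1) = Y1 at *
  -- The relation D dl ∧ dS = (lS - T) dS ∧ dT, from differentiating the equation for dX.
  have a : (1 + S w * T w) * (l0 * s1 - l1 * s0) = (l w * S w - T w) * (s0 * t1 - s1 * t0) := by
    linear_combination k1
  -- Similarly D dl ∧ dT = l(T - lS) dS ∧ dT, from the equation for l dY. Multiplying its derivative
  -- by l lets l dY be eliminated without dividing by l.
  have b : (1 + S w * T w) * (l0 * t1 - l1 * t0) =
      (l w * T w - l w ^ 2 * S w) * (s0 * t1 - s1 * t0) := by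
    linear_combination l w * k2 - l0 * y1 + l1 * y0
  -- Cramer's rule: dS ∧ dT ≠ 0, so dl is recovered from dl ∧ dS and dl ∧ dT.
  apply mul_left_cancel₀ hJ
  linear_combination (v 0 * s0 + v 1 * s1) * b - (v 0 * t0 + v 1 * t1) * a

/-- The integrability condition of the equation for the slope. -/
theorem slope_eq {S T X Y l : (Fin 2 → ℝ) → ℝ} {w : Fin 2 → ℝ}
    (H : ∀ᶠ z in 𝓝 w, ContDiffAt ℝ ∞ S z ∧ ContDiffAt ℝ ∞ T z ∧ ContDiffAt ℝ ∞ X z ∧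
      ContDiffAt ℝ ∞ Y z ∧ ContDiffAt ℝ ∞ l z ∧
      fderiv ℝ S z (Pi.single 0 1) * fderiv ℝ T z (Pi.single 1 1) -
        fderiv ℝ S z (Pi.single 1 1) * fderiv ℝ T z (Pi.single 0 1) ≠ 0)
    (h1 : ∀ᶠ z in 𝓝 w, ∀ v, fderiv ℝ X z v =
      (l z * (1 + S z * T z) - T z ^ 2 / 2) * fderiv ℝ S z v)
    (h2 : ∀ᶠ z in 𝓝 w, ∀ v, l z * fderiv ℝ Y z v =
      (1 + S z * T z - l z * (S z ^ 2 / 2)) * fderiv ℝ T z v) :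
    l w * (1 + S w * T w) + (T w - S w * l w) ^ 2 = 0 := by
  have hE : ∀ᶠ z in 𝓝 w, ∀ v, (1 + S z * T z) * fderiv ℝ l z v =
      (T z * l z - S z * l z ^ 2) * fderiv ℝ S z v + (T z - S z * l z) * fderiv ℝ T z v := by
    filter_upwards [H, h1.eventually_nhds, h2.eventually_nhds]
      with z ⟨a, b, c, d, e, f⟩ k1 k2
    exact fderiv_slope a b c d e f k1 k2
  obtain ⟨hS, hT, -, -, hl, hJ⟩ := H.self_of_nhds
  have hS' := (hS.differentiableAt (by simp)).hasFDerivAt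
  have hT' := (hT.differentiableAt (by simp)).hasFDerivAt
  have hl' := (hl.differentiableAt (by simp)).hasFDerivAt
  have hG0 := (hS'.mul hT').const_add 1
  have hG1 := ((hT'.mul hl').sub (hS'.mul (hl'.pow 2))).neg
  have hG2 := (hT'.sub (hS'.mul hl')).neg
  have k := sum_wedge_fderiv_eq_zero (w := w) (g := ![_, _, _]) (g' := ![_, _, _]) (h := ![l, S, T])
    (by
      intro i
      fin_cases i
      · exact hG0
      · exact hG1
      · exact hG2)
    (by
      intro i
      fin_cases i
      · exact hl
      · exact hS
      · exact hT)
    (by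
      filter_upwards [hE] with z hz v
      simp [Fin.sum_univ_three]
      linear_combination hz v) (Pi.single 0 1) (Pi.single 1 1)
  have e0 := hE.self_of_nhds (Pi.single 0 1)
  have e1 := hE.self_of_nhds (Pi.single 1 1)
  simp [Fin.sum_univ_three] at k
  generalize fderiv ℝ S w (Pi.single 0 1) = s0 at *
  generalize fderiv ℝ S w (Pi.single 1 1) = s1 at *
  generalize fderiv ℝ T w (Pi.single 0 1) = t0 at *
  generalize fderiv ℝ T w (Pi.single 1 1) = t1 at *
  generalize fderiv ℝ l w (Pi.single 0 1) = l0 at *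
  generalize fderiv ℝ l w (Pi.single 1 1) = l1 at *
  -- After multiplication by D and elimination of dl, the differentiated equation reads 2(lD + (T -
  -- Sl)²) dS ∧ dT = 0; hence the factor 1/2.
  apply mul_left_cancel₀ hJ
  linear_combination (1 + S w * T w) / 2 * k - (T w - S w * l w) * (s0 * e1 - s1 * e0)

theorem mem_transversalPlane_webMap (ξ : Fin 2 → ℝ) (P z : Space) :
    z ∈ transversalPlane webMap ξ P ↔
      ξ 1 * ((1 + P.1 0 * P.2 1) * z.1 0) - ξ 0 * (P.2 1 ^ 2 / 2 * z.1 0 + z.1 1) = 0 ∧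
        ξ 1 * (z.2 0 + P.1 0 ^ 2 / 2 * z.2 1) - ξ 0 * ((1 + P.1 0 * P.2 1) * z.2 1) = 0 := by
  rw [transversalPlane, Submodule.mem_inf, LinearMap.mem_ker, LinearMap.mem_ker, om1_webMap_zero,
    om1_webMap_one, om2_webMap_zero, om2_webMap_one]
  rfl

/-- The second expression is the quadratic s²l² + (1 - st)l + t². If it vanished at the three
nonzero values 1, -1, 2, all its coefficients would be zero, but s = t = 0 makes the linear one
equal to 1. -/
theorem exists_slope (s t : ℝ) : ∃ l : ℝ, l ≠ 0 ∧ l * (1 + s * t) + (t - s * l) ^ 2 ≠ 0 := by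
  by_contra! h
  have h1 := h 1 one_ne_zero
  have h2 := h (-1) (by norm_num)
  have h3 := h 2 two_ne_zero
  have hs : s ^ 2 = 0 := by linear_combination (-3 * h1 + h2 + 2 * h3) / 6
  have ht : t ^ 2 = 0 := by linear_combination (h1 + h2) / 2 - hs
  rw [pow_eq_zero_iff two_ne_zero] at hs ht
  simp [hs, ht] at h1

/-- The plane of slope l₀ at P, with l₀ from `exists_slope`, violates the necessary condition of
`slope_eq`. The work lies in showing that a surface tangent to it has a smooth slope function and
that S, T are local coordinates on it. -/
theorem not_isTransversallyGeodesic_webMap {U : Set Space}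
    (h : ∀ P ∈ U, 1 + P.1 0 * P.2 1 ≠ 0) {P : Space} (hP : P ∈ U) :
    ¬ IsTransversallyGeodesic webMap U := by
  intro hI
  obtain ⟨l₀, hl₀, hne⟩ := exists_slope (P.1 0) (P.2 1)
  obtain ⟨W, φ, hW, h0, rfl, hWU, hφ, H0, H⟩ := hI P hP ![1, l₀] (fun e => by
    simpa using congrFun e 0)
  have hd (w) (hw : w ∈ W) : DifferentiableAt ℝ φ w :=
    (hφ.contDiffAt (hW.mem_nhds hw)).differentiableAt (by simp)
  have hD := h _ hP
  -- The vectors u and v map to the intersections of the transversal plane with the leaves y = const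
  -- and x = const.
  obtain ⟨u, hu⟩ : ((![1, l₀ * (1 + (φ 0).1 0 * (φ 0).2 1) - (φ 0).2 1 ^ 2 / 2], 0) : Space) ∈
      LinearMap.range (fderiv ℝ φ 0).toLinearMap := by
    rw [H0, mem_transversalPlane_webMap]
    simp
  obtain ⟨v, hv⟩ :
      ((0, ![1 + (φ 0).1 0 * (φ 0).2 1 - l₀ * ((φ 0).1 0 ^ 2 / 2), l₀]) : Space) ∈
      LinearMap.range (fderiv ℝ φ 0).toLinearMap := by
    rw [H0, mem_transversalPlane_webMap]
    simp
    ring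
  rw [ContinuousLinearMap.coe_coe] at hu hv
  set S : (Fin 2 → ℝ) → ℝ := fun z => (φ z).1 0
  set X : (Fin 2 → ℝ) → ℝ := fun z => (φ z).1 1
  set Y : (Fin 2 → ℝ) → ℝ := fun z => (φ z).2 0
  set T : (Fin 2 → ℝ) → ℝ := fun z => (φ z).2 1
  have hS (w) (hw : w ∈ W) : ContDiffAt ℝ ∞ S w := (contDiffAt_coord_of_contDiffOn hW hφ hw 0).1
  have hX (w) (hw : w ∈ W) : ContDiffAt ℝ ∞ X w := (contDiffAt_coord_of_contDiffOn hW hφ hw 1).1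
  have hY (w) (hw : w ∈ W) : ContDiffAt ℝ ∞ Y w := (contDiffAt_coord_of_contDiffOn hW hφ hw 0).2
  have hT (w) (hw : w ∈ W) : ContDiffAt ℝ ∞ T w := (contDiffAt_coord_of_contDiffOn hW hφ hw 1).2
  have hder {g : (Fin 2 → ℝ) → ℝ} {w : Fin 2 → ℝ} (hg : ContDiffAt ℝ ∞ g w) (v : Fin 2 → ℝ) :
      ContDiffAt ℝ ∞ (fun z => fderiv ℝ g z v) w :=
    (hg.fderiv_right (m := ∞) (by simp)).clm_apply contDiffAt_const
  -- The covectors η are given pointwise with no regularity. Solving the first plane equation on the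
  -- fixed vector u expresses the slope η²/η¹ through derivatives of the surface, so it is smooth
  -- wherever dS(u) ≠ 0.
  let l : (Fin 2 → ℝ) → ℝ := fun z =>
    (T z ^ 2 / 2 * fderiv ℝ S z u + fderiv ℝ X z u) / ((1 + S z * T z) * fderiv ℝ S z u)
  have hl (w) (hw : w ∈ W) (hw' : fderiv ℝ S w u ≠ 0) : ContDiffAt ℝ ∞ l w :=
    ((((hT w hw).pow 2).div_const 2).mul (hder (hS w hw) u) |>.add (hder (hX w hw) u)).div
      ((contDiffAt_const.add ((hS w hw).mul (hT w hw))).mul (hder (hS w hw) u))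
      (mul_ne_zero (h _ (hWU hw)) hw')
  have dS (w) (hw : w ∈ W) (v) : fderiv ℝ S w v = (fderiv ℝ φ w v).1 0 :=
    fderiv_fst_apply (hd w hw) 0 v
  have dX (w) (hw : w ∈ W) (v) : fderiv ℝ X w v = (fderiv ℝ φ w v).1 1 :=
    fderiv_fst_apply (hd w hw) 1 v
  have dY (w) (hw : w ∈ W) (v) : fderiv ℝ Y w v = (fderiv ℝ φ w v).2 0 :=
    fderiv_snd_apply (hd w hw) 0 v
  have dT (w) (hw : w ∈ W) (v) : fderiv ℝ T w v = (fderiv ℝ φ w v).2 1 :=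
    fderiv_snd_apply (hd w hw) 1 v
  have Su : fderiv ℝ S 0 u = 1 := by simp [dS 0 h0, hu]
  have Tu : fderiv ℝ T 0 u = 0 := by simp [dT 0 h0, hu]
  have Sv : fderiv ℝ S 0 v = 0 := by simp [dS 0 h0, hv]
  have Tv : fderiv ℝ T 0 v = l₀ := by simp [dT 0 h0, hv]
  have Xu : fderiv ℝ X 0 u = l₀ * (1 + S 0 * T 0) - T 0 ^ 2 / 2 := by simp [dX 0 h0, hu, S, T]
  have l0 : l 0 = l₀ := by
    have hD' : 1 + S 0 * T 0 ≠ 0 := hD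
    simp only [l, Su, Xu]
    rw [div_eq_iff (mul_ne_zero hD' one_ne_zero)]
    ring
  have hSu : ∀ᶠ w in 𝓝 (0 : Fin 2 → ℝ), fderiv ℝ S w u ≠ 0 :=
    (hder (hS 0 h0) u).continuousAt.eventually_ne (by rw [Su]; exact one_ne_zero)
  have hJ : ∀ᶠ z in 𝓝 (0 : Fin 2 → ℝ),
      fderiv ℝ S z (Pi.single 0 1) * fderiv ℝ T z (Pi.single 1 1) -
        fderiv ℝ S z (Pi.single 1 1) * fderiv ℝ T z (Pi.single 0 1) ≠ 0 := by
    have hc := ((hder (hS 0 h0) (Pi.single 0 1)).mul (hder (hT 0 h0) (Pi.single 1 1))).sub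
      ((hder (hS 0 h0) (Pi.single 1 1)).mul (hder (hT 0 h0) (Pi.single 0 1)))
    -- The value of dS ∧ dT on (u, v) at 0 is l₀; this is where l₀ ≠ 0 is needed.
    refine hc.continuousAt.eventually_ne fun e => hl₀ ?_
    rw [fderiv_apply_eq_fin_two] at Su Tu Sv Tv
    have h1 : l₀ = (u 0 * v 1 - u 1 * v 0) *
        (fderiv ℝ S 0 (Pi.single 0 1) * fderiv ℝ T 0 (Pi.single 1 1) -
        fderiv ℝ S 0 (Pi.single 1 1) * fderiv ℝ T 0 (Pi.single 0 1)) := by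
      linear_combination -l₀ * Su - (u 0 * fderiv ℝ S 0 (Pi.single 0 1) +
        u 1 * fderiv ℝ S 0 (Pi.single 1 1)) * Tv + (u 0 * fderiv ℝ T 0 (Pi.single 0 1) +
        u 1 * fderiv ℝ T 0 (Pi.single 1 1)) * Sv
    rw [h1, e, mul_zero]
  have key : ∀ᶠ z in 𝓝 (0 : Fin 2 → ℝ), ∀ v,
      (fderiv ℝ X z v = (l z * (1 + S z * T z) - T z ^ 2 / 2) * fderiv ℝ S z v) ∧
      (l z * fderiv ℝ Y z v = (1 + S z * T z - l z * (S z ^ 2 / 2)) * fderiv ℝ T z v) := by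
    filter_upwards [hW.mem_nhds h0, hSu] with w hw hwu v
    obtain ⟨-, η, hη, hr⟩ := H w hw
    have hm (v) : fderiv ℝ φ w v ∈ transversalPlane webMap η (φ w) := by
      rw [← hr]
      exact ⟨v, rfl⟩
    simp only [mem_transversalPlane_webMap, ← dS w hw, ← dX w hw, ← dY w hw, ← dT w hw] at hm
    have hDw : 1 + S w * T w ≠ 0 := h _ (hWU hw)
    have hlw : l w * ((1 + S w * T w) * fderiv ℝ S w u) =
        T w ^ 2 / 2 * fderiv ℝ S w u + fderiv ℝ X w u :=
      div_mul_cancel₀ _ (mul_ne_zero hDw hwu)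
    -- The plane equation on u identifies l with the slope of η. In particular η¹ ≠ 0, as otherwise
    -- η would vanish.
    have hη1 : η 1 = l w * η 0 := by
      apply mul_right_cancel₀ (mul_ne_zero hDw hwu)
      linear_combination (hm u).1 - η 0 * hlw
    have hη0 : η 0 ≠ 0 := by
      intro e
      apply hη
      funext i
      fin_cases i
      · exact e
      · simp [hη1, e]
    have m1 := (hm v).1
    have m2 := (hm v).2
    rw [hη1] at m1 m2
    constructor
    · apply mul_left_cancel₀ hη0
      linear_combination -m1
    · apply mul_left_cancel₀ hη0
      linear_combination m2
  have := slope_eq (w := 0) (by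
      filter_upwards [hW.mem_nhds h0, hSu, hJ] with w hw hwu hwJ
      exact ⟨hS w hw, hT w hw, hX w hw, hY w hw, hl w hw hwu, hwJ⟩)
    (key.mono fun z hz v => (hz v).1) (key.mono fun z hz v => (hz v).2)
  rw [l0] at this
  exact hne this

end ThreeWeb

/-! ### Assembly -/

theorem mainTheorem9 :
    Dense {P : Space | 1 + P.1 0 * P.2 1 ≠ 0 ∧ P.1 0 * P.2 1 ≠ 1 ∧
      P.1 0 ≠ 0 ∧ P.2 1 ≠ 0 ∧ P.1 0 ≠ -P.2 1} ∧
    ∀ U : Set Space, IsOpen U → U.Nonempty → (∀ P ∈ U, 1 + P.1 0 * P.2 1 ≠ 0) →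
      IsThreeWeb webMap U ∧
      -- the distribution `a₁ ω₁¹ - a₂ ω₂² = 0`
      ((∀ P ∈ U, ∃ i, covec webMap i P ≠ 0) →
        ((∀ P ∈ U, pT webMap 1 0 P = -qT webMap 0 1 P) ↔
          IsIntegrable 3 (thetaDist webMap) U)) ∧
      (∀ P ∈ U, ∀ u v : Space,
        extD (thetaForm webMap) P u v =
          wedge (nablaA webMap 0 P) (om1 webMap 0 P) u v -
            wedge (nablaA webMap 1 P) (om2 webMap 1 P) u v) ∧
      (∀ P ∈ U,
        (wedge (nablaA webMap 0 P) (om1 webMap 0 P) = wedge (nablaA webMap 1 P) (om2 webMap 1 P) ↔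
          pT webMap 1 0 P = -qT webMap 0 1 P)) ∧
      -- the distributions `ω₁ⁱ + ω₂ⁱ = 0`
      (∀ i, IsIntegrable 3 (sumDist webMap i) U) ∧
      -- the classes
      (∀ P ∈ U, pAlt webMap P = qAlt webMap P ∧
        (∀ i, pT webMap i 1 P = 0 ∧ qT webMap i 0 P = 0) ∧
        pT webMap 1 0 P = -qT webMap 0 1 P) ∧
      (InClassG3 webMap U ↔ ∀ P ∈ U, P.1 0 * P.2 1 ≠ 1) ∧
      (InClassE111 webMap U ↔ ∀ P ∈ U, P.1 0 ≠ 0 ∧ P.2 1 ≠ 0 ∧ P.1 0 ≠ -P.2 1) ∧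
      InClassB webMap U ∧
      InClassC webMap U := by
  refine ⟨dense_generic, fun U hU hne h => ?_⟩
  -- Density supplies a point of U with x¹ ≠ 0 and y² ≠ 0, at which the conditions of class B fail.
  obtain ⟨P, hPU, -, -, hs, ht, -⟩ : ∃ P ∈ U, 1 + P.1 0 * P.2 1 ≠ 0 ∧ P.1 0 * P.2 1 ≠ 1 ∧
      P.1 0 ≠ 0 ∧ P.2 1 ≠ 0 ∧ P.1 0 ≠ -P.2 1 := by
    obtain ⟨P, hP, hPU⟩ := dense_generic.exists_mem_open hU hne
    exact ⟨P, hPU, hP⟩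
  refine ⟨isThreeWeb_webMap hU h, fun ha => ⟨fun _ => isIntegrable_thetaDist_webMap hU h ha,
    fun _ Q hQ => pT_eq_neg_qT_webMap (h Q hQ)⟩, fun Q hQ u v => ?_, fun Q hQ =>
    ⟨fun _ => pT_eq_neg_qT_webMap (h Q hQ), fun _ => wedge_nablaA_webMap (h Q hQ)⟩,
    fun i => ?_, fun Q hQ => ⟨?_, fun i => ?_, pT_eq_neg_qT_webMap (h Q hQ)⟩,
    inClassG3_webMap_iff h, inClassE111_webMap_iff h,
    ⟨not_isIntegrable_transversalDist_webMap h hPU hs ht,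
      fun hT => not_transversalCondition_webMap (h P hPU) hs ht (hT P hPU)⟩,
    ⟨not_isTransversallyGeodesic_webMap h hPU,
      fun hC => not_curvatureCondition_webMap (h P hPU) (hC P hPU)⟩⟩
  · rw [extD_thetaForm_webMap (h Q hQ), wedge_nablaA_webMap (h Q hQ), sub_self]
  · fin_cases i
    · exact isIntegrable_sumDist_webMap_zero hU
    · exact isIntegrable_sumDist_webMap_one hU
  · rw [pAlt_webMap (h Q hQ), qAlt_webMap (h Q hQ)]
  · exact pT_one_eq_zero_webMap (h Q hQ) i
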